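/- Let $(R,\oplus,\odot)$ be a valuative semifield: a semifield with additive identity $\infty$ such that $R^*=R\setminus\{\infty\}$ is a totally ordered abelian group under $\odot$, $\infty$ is larger than every element of $R^*$, and $a\oplus b=\min(a,b)$ (for example $R=\mathbb R\cup\{\infty\}$ with $\odot=+$). A valuated matroid $\mathcal M=(E,p)$ of rank $r$ on a finite set $E$ with values in $R$ is a function $p:\binom{E}{r}\to R$, not identically $\infty$, such that for all $A,B\in\binom{E}{r}$ and $a\in A\setminus B$ there is $b\in B\setminus A$ with $p(A)\odot p(B)\ge p(A\cup b-a)\odot p(B\cup a-b)$. Set $p(B)=\infty$ when $|B|\ne r$. For $B$ with $p(B)\neq\infty$ and $e\in E\setminus B$, let $H(B,e)\in R^E$ be given by $H(B,e)_{e'}=p(B\cup e-e')/p(B)$, where $/$ is division in $R$. The circuits of $\mathcal M$ are the vectors $\lambda\odot H(B,e)$ with $\lambda\in R^*$, and $\mathcal V(\mathcal M)\subseteq R^E$, the set of vectors of $\mathcal M$, is the $R$-subsemimodule generated by the circuits. Let $n\ge 0$ and let $\mathrm{Mon}_d$ be the set of monomials of degree $d$ in $x_0,\dots,x_n$; identify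 $R^{\mathrm{Mon}_d}$ with the homogeneous polynomials of degree $d$ in $R[x_0,\dots,x_n]$. Let $\mathcal S=(\mathcal M_d)_{d\ge 0}$ be a sequence of valuated matroids with values in $R$, where $\mathcal M_d=(\mathrm{Mon}_d,p_d)$ has rank $r_d$. The sequence $\mathcal S$ is called compatible if the $R$-subsemimodule of $R[x_0,\dots,x_n]$ generated by all the $\mathcal V(\mathcal M_d)$, $d\ge 0$, is a homogeneous ideal. **Proposition (Compatibility in terms of basis valuations).** The sequence $\mathcal S$ is compatible if and only if for every $d\ge 0$, every variable $x_i$, every $U\subseteq\mathrm{Mon}_d$ of size $r_d+1$ and every $V\subseteq\mathrm{Mon}_{d+1}$ of size $r_{d+1}-1$, $$\min_{\mathbf x^{\mathbf u}\in x_iU\setminus V}\ p_d\bigl(U-\mathbf x^{\mathbf u}/x_i\bigr)\odot p_{d+1}\bigl(V\cup\mathbf x^{\mathbf u}\bigr)\quad\text{is attained at least twice,}$$ where, as usual, this condition is understood to hold if the minimum equals $\infty$ (in particular if $x_iU\setminus V$ is empty). If $r_{d+1}=0$ there is no such $V$ and the condition is vacuous. -/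

import Mathlib

/-- A valuative semifield: a semifield with a total order for which addition is the minimum.
The additive identity `0` of `R` plays the role of `∞` and multiplication is tropical
multiplication.  By the semifield laws `0` is then the largest element, and multiplication is
monotone, so the nonzero elements form a totally ordered abelian group. -/
class ValuativeSemifield (R : Type*) [Semifield R] [LinearOrder R] : Prop where
  add_eq_min : ∀ a b : R, a + b = min a b

/-- A valuated matroid on the finite ground set `E` with values in `R`.  The basis valuation
function on subsets of size `rank` is extended by `∞` (that is, `0 : R`) to all other subsets. -/
structure ValuatedMatroid (E R : Type*) [Fintype E] [DecidableEq E] [Semifield R]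
    [LinearOrder R] where
  /-- the rank -/
  rank : ℕ
  /-- the basis valuation function -/
  p : Finset E → R
  p_of_card_ne : ∀ B : Finset E, B.card ≠ rank → p B = 0
  exists_basis : ∃ B : Finset E, B.card = rank ∧ p B ≠ 0
  exchange : ∀ A B : Finset E, A.card = rank → B.card = rank → ∀ a ∈ A \ B, ∃ b ∈ B \ A,
    p ((insert b A).erase a) * p ((insert a B).erase b) ≤ p A * p B

namespace ValuatedMatroid

variable {E R : Type*} [Fintype E] [DecidableEq E] [Semifield R] [LinearOrder R]

/-- The valuated fundamental circuit `H(B, e)`, with coordinates `p(B ∪ e - e') / p(B)`. -/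
def fundamentalCircuit (M : ValuatedMatroid E R) (B : Finset E) (e : E) : E → R :=
  fun e' => M.p ((insert e B).erase e') / M.p B

/-- The valuated circuits: nonzero multiples of the fundamental circuits `H(B, e)`, where `B` is a
basis of the underlying matroid and `e ∉ B`. -/
def circuits (M : ValuatedMatroid E R) : Set (E → R) :=
  {G | ∃ (B : Finset E) (e : E) (c : R), M.p B ≠ 0 ∧ e ∉ B ∧ c ≠ 0 ∧
    G = c • M.fundamentalCircuit B e}

/-- The vectors: the subsemimodule of `R^E` generated by the valuated circuits. -/
def vectors (M : ValuatedMatroid E R) : Submodule R (E → R) :=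
  Submodule.span R M.circuits

end ValuatedMatroid

/-- The monomials of degree `d` in the variables `x_0, …, x_n`, given by their exponents. -/
abbrev MonDeg (n d : ℕ) : Type := {u : Fin (n + 1) →₀ ℕ // u.degree = d}

noncomputable instance MonDeg.instFintype (n d : ℕ) : Fintype (MonDeg n d) :=
  Fintype.subtype (Finset.finsuppAntidiag Finset.univ d) (fun u => by
    simp [Finset.mem_finsuppAntidiag, Finsupp.degree_eq_sum])

/-- Multiplication of a monomial of degree `d` by the variable `x_i`. -/
noncomputable def MonDeg.mulVar {n d : ℕ} (i : Fin (n + 1)) (u : MonDeg n d) :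
    MonDeg n (d + 1) :=
  ⟨u.1 + Finsupp.single i 1, by rw [map_add, u.2, Finsupp.degree_single]⟩

/-- The homogeneous polynomial of degree `d` identified with an element of `R^{Mon_d}`. -/
noncomputable def homogPoly {n d : ℕ} {R : Type*} [CommSemiring R] (f : MonDeg n d → R) :
    MvPolynomial (Fin (n + 1)) R :=
  ∑ u : MonDeg n d, MvPolynomial.monomial u.1 (f u)

/-- The subsemimodule of `R[x_0, …, x_n]` generated by the vectors of all the `M d`. -/
noncomputable def generatedSemimodule {n : ℕ} {R : Type*} [Semifield R] [LinearOrder R]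
    (M : (d : ℕ) → ValuatedMatroid (MonDeg n d) R) :
    Submodule R (MvPolynomial (Fin (n + 1)) R) :=
  Submodule.span R (⋃ d : ℕ, homogPoly '' ((M d).vectors : Set (MonDeg n d → R)))

section

attribute [local instance] MvPolynomial.gradedAlgebra

/-- The sequence `M` is compatible: the subsemimodule generated by the vectors of all the `M d` is
a homogeneous ideal of the polynomial semiring. -/
def IsCompatibleSeq {n : ℕ} {R : Type*} [Semifield R] [LinearOrder R]
    (M : (d : ℕ) → ValuatedMatroid (MonDeg n d) R) : Prop :=
  ∃ J : Ideal (MvPolynomial (Fin (n + 1)) R),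
    J.IsHomogeneous (MvPolynomial.homogeneousSubmodule (Fin (n + 1)) R) ∧
      (J : Set (MvPolynomial (Fin (n + 1)) R)) = (generatedSemimodule M : Set _)

end

/-- The minimum of `f` over `s` is attained at least twice, with the usual tropical convention
that this holds if the minimum is `∞` (in particular if `s` is empty). -/
def MinAttainedTwice {ι R : Type*} [Zero R] [LE R] (s : Finset ι) (f : ι → R) : Prop :=
  (∀ j ∈ s, f j = 0) ∨ ∃ j ∈ s, ∃ k ∈ s, j ≠ k ∧ f j = f k ∧ ∀ l ∈ s, f j ≤ f l

/-!
The proof has two ingredients.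

*Vectors are the orthogonal complement of the cocircuits.*  Let `M` be a valuated matroid of rank
`r`.  A set `U` of size `r + 1` gives the circuit `v ↦ p (U - v)` and a set `V` of size `r - 1` the
cocircuit `w ↦ p (V ∪ w)` (both may be identically `∞`).  A vector is orthogonal to `c` if the
minimum of `x w ⊙ c w` over all `w` is attained at least twice; these `x` form a subsemimodule.
Circuits are orthogonal to cocircuits: this is the exchange axiom for the bases `V ∪ v` and `U - v`.
Conversely, if `x` is orthogonal to all cocircuits and `x e ≠ ∞`, some circuit lies above `x` and
agrees with it at `e`, so that `x` is the sum of these circuits.  To find it, take among the bases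
`B` that meet the support of `x` in as many elements as possible one minimizing
`p B ⊙ ∏ x b`, the product over the `b ∈ B` in that support.  Orthogonality to the cocircuit of
`B - e` allows one to choose `B` with `e ∉ B`, and extremality of `B` says precisely that
`x e ⊙ H(B, e) ≥ x`.  See `ValuatedMatroid.mem_vectors_iff`.

*Compatibility is closure under multiplication by variables.*  A polynomial lies in the generated
subsemimodule iff all its homogeneous parts are vectors (`mem_generatedSemimodule_iff`), so
compatibility means that `x_i` maps vectors of `M d` to vectors of `M (d + 1)`.  It suffices to test
this on circuits of `M d`, and by the first ingredient against cocircuits of `M (d + 1)`; this is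
the stated condition.
-/

/-! ### Order and arithmetic in a valuative semifield -/

namespace ValuativeSemifield

variable {R : Type*} [Semifield R] [LinearOrder R] [ValuativeSemifield R]

theorem le_iff_add_eq {a b : R} : a ≤ b ↔ a + b = a := by
  rw [add_eq_min, min_eq_left_iff]

theorem le_zero (a : R) : a ≤ 0 := by
  rw [le_iff_add_eq, add_zero]

theorem ne_zero_of_le {a b : R} (h : a ≤ b) (hb : b ≠ 0) : a ≠ 0 := by
  rintro rfl
  exact hb (le_antisymm (le_zero b) h)

theorem mul_le_mul_left {a b : R} (h : a ≤ b) (c : R) : c * a ≤ c * b := by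
  rw [le_iff_add_eq] at h ⊢
  rw [← mul_add, h]

theorem mul_le_mul_right {a b : R} (h : a ≤ b) (c : R) : a * c ≤ b * c := by
  rw [mul_comm a, mul_comm b]
  exact mul_le_mul_left h c

theorem le_of_mul_le_mul_right {a b c : R} (h : a * c ≤ b * c) (hc : c ≠ 0) : a ≤ b := by
  have := mul_le_mul_right h c⁻¹
  rwa [mul_inv_cancel_right₀ hc, mul_inv_cancel_right₀ hc] at this

theorem le_sum {ι : Type*} {s : Finset ι} {f : ι → R} {a : R} (h : ∀ i ∈ s, a ≤ f i) :
    a ≤ ∑ i ∈ s, f i := by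
  classical
  induction s using Finset.induction_on with
  | empty => simpa using le_zero a
  | insert i s hi ih =>
    rw [Finset.sum_insert hi, add_eq_min]
    exact le_min (h i (Finset.mem_insert_self i s))
      (ih fun j hj => h j (Finset.mem_insert_of_mem hj))

theorem sum_le {ι : Type*} {s : Finset ι} (f : ι → R) {i : ι} (hi : i ∈ s) :
    ∑ j ∈ s, f j ≤ f i := by
  classical
  rw [← Finset.add_sum_erase s f hi, add_eq_min]
  exact min_le_left _ _

/-- The minimum over a finite set is attained twice iff no finite value is strictly smaller than
all other values. -/
theorem minAttainedTwice_iff {ι : Type*} {s : Finset ι} {f : ι → R} :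
    MinAttainedTwice s f ↔ ∀ j ∈ s, f j ≠ 0 → ∃ k ∈ s, k ≠ j ∧ f k ≤ f j := by
  constructor
  · rintro (h | ⟨j, hj, k, hk, hjk, heq, hmin⟩) l hl hne
    · exact absurd (h l hl) hne
    · by_cases hlj : l = j
      · subst hlj
        exact ⟨k, hk, hjk.symm, heq.ge⟩
      · exact ⟨j, hj, Ne.symm hlj, hmin l hl⟩
  · intro h
    by_cases h0 : ∀ j ∈ s, f j = 0
    · exact Or.inl h0
    · push Not at h0
      obtain ⟨l, hl, hl0⟩ := h0
      obtain ⟨j, hj, hmin⟩ := s.exists_min_image f ⟨l, hl⟩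
      obtain ⟨k, hk, hkj, hle⟩ := h j hj (ne_zero_of_le (hmin l hl) hl0)
      exact Or.inr ⟨j, hj, k, hk, hkj.symm, le_antisymm (hmin k hk) hle, hmin⟩

/-- The tropical orthogonal complement of `c`: the `x` for which the minimum of `x w * c w` is
attained at least twice, in the form of `minAttainedTwice_iff`. -/
def orthogonal {E : Type*} (c : E → R) : Submodule R (E → R) where
  carrier := {x | ∀ j, x j * c j ≠ 0 → ∃ k, k ≠ j ∧ x k * c k ≤ x j * c j}
  zero_mem' := by
    intro j hj
    simp at hj
  add_mem' := by
    intro x y hx hy j hj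
    have key : ∀ k, (x + y) k * c k ≤ x k * c k ∧ (x + y) k * c k ≤ y k * c k := by
      intro k
      rw [Pi.add_apply, add_mul, add_eq_min]
      exact ⟨min_le_left _ _, min_le_right _ _⟩
    have hmin : (x + y) j * c j = min (x j * c j) (y j * c j) := by
      rw [Pi.add_apply, add_mul, add_eq_min]
    rcases min_choice (x j * c j) (y j * c j) with h | h <;> rw [h] at hmin <;>
      rw [hmin] at hj ⊢
    · obtain ⟨k, hk, hle⟩ := hx j hj
      exact ⟨k, hk, (key k).1.trans hle⟩
    · obtain ⟨k, hk, hle⟩ := hy j hj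
      exact ⟨k, hk, (key k).2.trans hle⟩
  smul_mem' := by
    intro a x hx j hj
    simp only [Pi.smul_apply, smul_eq_mul, mul_assoc] at hj ⊢
    obtain ⟨k, hk, hle⟩ := hx j (right_ne_zero_of_mul hj)
    exact ⟨k, hk, mul_le_mul_left hle a⟩

theorem mem_orthogonal {E : Type*} {c x : E → R} :
    x ∈ orthogonal c ↔ ∀ j, x j * c j ≠ 0 → ∃ k, k ≠ j ∧ x k * c k ≤ x j * c j :=
  Iff.rfl

end ValuativeSemifield

/-! ### Vectors and cocircuits of a valuated matroid -/

namespace ValuatedMatroid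

open ValuativeSemifield

variable {E R : Type*} [Fintype E] [DecidableEq E] [Semifield R] [LinearOrder R]

theorem card_of_p_ne_zero (M : ValuatedMatroid E R) {B : Finset E} (h : M.p B ≠ 0) :
    B.card = M.rank :=
  by_contra fun hB => h (M.p_of_card_ne B hB)

/-- The circuit `v ↦ p (U - v)` of a set `U` of size `rank + 1`.  For `v ∉ U` the set `U.erase v`
has the wrong size, so that the value is `∞`, as it should be. -/
def circuitOf (M : ValuatedMatroid E R) (U : Finset E) : E → R :=
  fun v => M.p (U.erase v)

/-- The cocircuit `w ↦ p (V ∪ w)` of a set `V` of size `rank - 1`.  For `w ∈ V` the set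
`insert w V` has the wrong size, so that the value is `∞`, as it should be. -/
def cocircuitOf (M : ValuatedMatroid E R) (V : Finset E) : E → R :=
  fun w => M.p (insert w V)

theorem circuitOf_ne_zero (M : ValuatedMatroid E R) {U : Finset E}
    (hU : U.card = M.rank + 1) {v : E} (h : M.circuitOf U v ≠ 0) : v ∈ U := by
  by_contra hv
  have := M.card_of_p_ne_zero h
  rw [Finset.erase_eq_of_notMem hv] at this
  omega

theorem cocircuitOf_ne_zero (M : ValuatedMatroid E R) {V : Finset E}
    (hV : V.card + 1 = M.rank) {w : E} (h : M.cocircuitOf V w ≠ 0) : w ∉ V := by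
  intro hw
  have := M.card_of_p_ne_zero h
  rw [Finset.insert_eq_of_mem hw] at this
  omega

theorem fundamentalCircuit_eq_smul (M : ValuatedMatroid E R) (B : Finset E) (e : E) :
    M.fundamentalCircuit B e = (M.p B)⁻¹ • M.circuitOf (insert e B) := by
  funext f
  simp only [fundamentalCircuit, circuitOf, Pi.smul_apply, smul_eq_mul]
  rw [div_eq_inv_mul]

theorem circuitOf_mem_vectors (M : ValuatedMatroid E R) {U : Finset E}
    (hU : U.card = M.rank + 1) : M.circuitOf U ∈ M.vectors := by
  by_cases h : ∃ e, M.circuitOf U e ≠ 0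
  · obtain ⟨e, he⟩ := h
    have heU := M.circuitOf_ne_zero hU he
    refine Submodule.subset_span ⟨U.erase e, e, M.p (U.erase e), he, by simp, he, ?_⟩
    have he' : M.p (U.erase e) * (M.p (U.erase e))⁻¹ = 1 := mul_inv_cancel₀ he
    rw [fundamentalCircuit_eq_smul, Finset.insert_erase heU, smul_smul, he', one_smul]
  · push Not at h
    rw [show M.circuitOf U = 0 from funext h]
    exact Submodule.zero_mem _

/-- The vectors are spanned by the circuits of all sets of size `rank + 1`. -/
theorem vectors_eq_span_circuitOf (M : ValuatedMatroid E R) :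
    M.vectors = Submodule.span R {x | ∃ U : Finset E, U.card = M.rank + 1 ∧ x = M.circuitOf U} := by
  apply le_antisymm
  · refine Submodule.span_le.2 ?_
    rintro x ⟨B, e, c, hB, he, -, rfl⟩
    rw [fundamentalCircuit_eq_smul]
    refine Submodule.smul_mem _ _ (Submodule.smul_mem _ _ (Submodule.subset_span
      ⟨insert e B, ?_, rfl⟩))
    rw [Finset.card_insert_of_notMem he, M.card_of_p_ne_zero hB]
  · refine Submodule.span_le.2 ?_
    rintro x ⟨U, hU, rfl⟩
    exact M.circuitOf_mem_vectors hU

variable [ValuativeSemifield R]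

theorem circuitOf_mem_orthogonal (M : ValuatedMatroid E R) {U V : Finset E}
    (hU : U.card = M.rank + 1) (hV : V.card + 1 = M.rank) :
    M.circuitOf U ∈ orthogonal (M.cocircuitOf V) := by
  rw [mem_orthogonal]
  intro v hv
  have hvU := M.circuitOf_ne_zero hU (left_ne_zero_of_mul hv)
  have hvV := M.cocircuitOf_ne_zero hV (right_ne_zero_of_mul hv)
  obtain ⟨b, hb, hle⟩ := M.exchange (insert v V) (U.erase v)
    (M.card_of_p_ne_zero (right_ne_zero_of_mul hv))
    (M.card_of_p_ne_zero (left_ne_zero_of_mul hv)) v (by simp)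
  simp only [Finset.mem_sdiff, Finset.mem_erase, Finset.mem_insert, not_or] at hb
  refine ⟨b, hb.1.1, ?_⟩
  have h1 : (insert b (insert v V)).erase v = insert b V := by
    rw [Finset.insert_comm, Finset.erase_insert]
    simp [hvV, Ne.symm hb.1.1]
  rw [h1, Finset.insert_erase hvU] at hle
  simp only [circuitOf, cocircuitOf]
  rwa [mul_comm, mul_comm (M.p (U.erase v))]

/-- Above any `x` orthogonal to all cocircuits there is, for each `e`, a vector that agrees
with `x` at `e`: a multiple of a circuit, or zero if `x e = ∞`. -/
theorem exists_vector_ge (M : ValuatedMatroid E R) {x : E → R}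
    (hx : ∀ V : Finset E, V.card + 1 = M.rank → x ∈ orthogonal (M.cocircuitOf V)) (e : E) :
    ∃ G ∈ M.vectors, (∀ f, x f ≤ G f) ∧ G e = x e := by
  by_cases he : x e = 0
  · exact ⟨0, Submodule.zero_mem _, fun f => le_zero _, he.symm⟩
  let supp : Finset E → Finset E := fun B => B.filter fun b => x b ≠ 0
  let weight : Finset E → R := fun B => M.p B * ∏ b ∈ supp B, x b
  have supp_insert : ∀ (B : Finset E) (w : E), x w ≠ 0 → supp (insert w B) = insert w (supp B) := by
    intro B w hw
    simp only [supp, Finset.filter_insert, if_pos hw]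
  have card_supp : ∀ (B : Finset E) (w : E), w ∉ B → x w ≠ 0 →
      (supp (insert w B)).card = (supp B).card + 1 := by
    intro B w hwB hw
    rw [supp_insert B w hw, Finset.card_insert_of_notMem (by simp [supp, hwB])]
  have weight_insert : ∀ (B : Finset E) (w : E), w ∉ B → x w ≠ 0 →
      weight (insert w B) = x w * M.p (insert w B) * ∏ b ∈ supp B, x b := by
    intro B w hwB hw
    simp only [weight]
    rw [supp_insert B w hw, Finset.prod_insert (by simp [supp, hwB])]
    ring
  have prod_ne : ∀ B : Finset E, ∏ b ∈ supp B, x b ≠ 0 := fun B =>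
    Finset.prod_ne_zero_iff.2 fun b hb => (Finset.mem_filter.1 hb).2
  -- The bases that meet the support of `x` as much as possible, and among them a lightest one.
  obtain ⟨B₁, hB₁, hmax⟩ := (Finset.univ.filter fun B => M.p B ≠ 0).exists_max_image
    (fun B => (supp B).card) (by
      obtain ⟨B, -, hB⟩ := M.exists_basis
      exact ⟨B, by simpa using hB⟩)
  obtain ⟨B₂, hB₂, hmin⟩ := (Finset.univ.filter fun B =>
      M.p B ≠ 0 ∧ (supp B).card = (supp B₁).card).exists_min_image weight
    ⟨B₁, by simpa using hB₁⟩
  simp only [Finset.mem_filter, Finset.mem_univ, true_and] at hmax hB₂ hmin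
  -- Orthogonality to the cocircuit of `B₂ - e` moves `e` out of the basis.
  obtain ⟨B, hB0, hBcard, hBmin, heB⟩ : ∃ B, M.p B ≠ 0 ∧ (supp B).card = (supp B₁).card ∧
      (∀ A, M.p A ≠ 0 ∧ (supp A).card = (supp B₁).card → weight B ≤ weight A) ∧ e ∉ B := by
    by_cases heB₂ : e ∈ B₂
    · obtain ⟨V, heV, rfl⟩ : ∃ V, e ∉ V ∧ insert e V = B₂ :=
        ⟨B₂.erase e, by simp, Finset.insert_erase heB₂⟩
      have hVcard : V.card + 1 = M.rank := by
        rw [← M.card_of_p_ne_zero hB₂.1, Finset.card_insert_of_notMem heV]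
      have hne : x e * M.cocircuitOf V e ≠ 0 := mul_ne_zero he hB₂.1
      obtain ⟨w, hwe, hle⟩ := mem_orthogonal.1 (hx V hVcard) e hne
      have hw := ne_zero_of_le hle hne
      have hxw := left_ne_zero_of_mul hw
      have hwV := M.cocircuitOf_ne_zero hVcard (right_ne_zero_of_mul hw)
      refine ⟨insert w V, right_ne_zero_of_mul hw, ?_, fun A hA => ?_, ?_⟩
      · rw [card_supp V w hwV hxw, ← card_supp V e heV he]
        exact hB₂.2
      · refine le_trans ?_ (hmin A hA)
        rw [weight_insert V w hwV hxw, weight_insert V e heV he]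
        exact mul_le_mul_right hle _
      · simp [heV, Ne.symm hwe]
    · exact ⟨B₂, hB₂.1, hB₂.2, hmin, heB₂⟩
  refine ⟨x e • M.fundamentalCircuit B e, Submodule.subset_span
    ⟨B, e, x e, hB0, heB, he, rfl⟩, fun f => ?_, ?_⟩
  · simp only [Pi.smul_apply, smul_eq_mul, fundamentalCircuit]
    by_cases hf0 : x e * (M.p ((insert e B).erase f) / M.p B) = 0
    · rw [hf0]
      exact le_zero _
    have hp : M.p ((insert e B).erase f) ≠ 0 := (div_ne_zero_iff.1 (right_ne_zero_of_mul hf0)).1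
    by_cases hfe : f = e
    · subst hfe
      rw [Finset.erase_insert heB, div_self hB0, mul_one]
    have hfB : f ∈ B := by
      by_contra hfB
      have h1 := M.card_of_p_ne_zero hp
      rw [Finset.erase_eq_of_notMem (by simp [hfe, hfB]), Finset.card_insert_of_notMem heB,
        M.card_of_p_ne_zero hB0] at h1
      omega
    obtain ⟨V, hfV, rfl⟩ : ∃ V, f ∉ V ∧ insert f V = B :=
      ⟨B.erase f, by simp, Finset.insert_erase hfB⟩
    have heV : e ∉ V := fun h => heB (Finset.mem_insert_of_mem h)
    have hswap : (insert e (insert f V)).erase f = insert e V := by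
      rw [Finset.insert_comm, Finset.erase_insert]
      simp [hfV, hfe]
    rw [hswap] at hp ⊢
    have hxf : x f ≠ 0 := by
      -- Otherwise exchanging `f` for `e` would enlarge the intersection with the support.
      intro hxf
      have h1 := hmax _ hp
      rw [card_supp V e heV he, ← hBcard] at h1
      simp only [supp, Finset.filter_insert, hxf, ne_eq, not_true_eq_false, if_false] at h1
      omega
    have hle := hBmin (insert e V) ⟨hp, by
      rw [card_supp V e heV he, ← card_supp V f hfV hxf, hBcard]⟩
    rw [weight_insert V f hfV hxf, weight_insert V e heV he] at hle
    refine le_of_mul_le_mul_right (c := M.p (insert f V)) ?_ hB0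
    rw [mul_assoc, div_mul_cancel₀ _ hB0]
    exact le_of_mul_le_mul_right hle (prod_ne V)
  · simp only [Pi.smul_apply, smul_eq_mul, fundamentalCircuit]
    rw [Finset.erase_insert heB, div_self hB0, mul_one]

/-- The vectors of a valuated matroid form the tropical orthogonal complement of its cocircuits. -/
theorem mem_vectors_iff (M : ValuatedMatroid E R) {x : E → R} :
    x ∈ M.vectors ↔
      ∀ V : Finset E, V.card + 1 = M.rank → x ∈ orthogonal (M.cocircuitOf V) := by
  constructor
  · intro hx V hV
    rw [vectors_eq_span_circuitOf] at hx
    refine Submodule.span_le.2 ?_ hx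
    rintro _ ⟨U, hU, rfl⟩
    exact M.circuitOf_mem_orthogonal hU hV
  · intro hx
    choose G hG hle heq using M.exists_vector_ge hx
    have hsum : x = ∑ e, G e := by
      funext f
      rw [Finset.sum_apply]
      refine le_antisymm (le_sum fun e _ => hle e f) ?_
      rw [← heq f]
      exact sum_le (fun e => G e f) (Finset.mem_univ f)
    rw [hsum]
    exact Submodule.sum_mem _ fun e _ => hG e

end ValuatedMatroid

/-! ### Homogeneous parts of polynomials and multiplication by variables -/

section HomogeneousParts

variable {n : ℕ} {R : Type*}

theorem MonDeg.mulVar_injective {d : ℕ} (i : Fin (n + 1)) :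
    Function.Injective (MonDeg.mulVar (n := n) (d := d) i) := by
  intro u v h
  exact Subtype.ext (add_right_cancel (congrArg Subtype.val h))

/-- The homogeneous part of degree `d` of a polynomial, as a vector indexed by monomials. -/
noncomputable def coeffVec [CommSemiring R] (d : ℕ) :
    MvPolynomial (Fin (n + 1)) R →ₗ[R] (MonDeg n d → R) :=
  LinearMap.pi fun u => MvPolynomial.lcoeff R u.1

theorem coeffVec_apply [CommSemiring R] (d : ℕ) (F : MvPolynomial (Fin (n + 1)) R)
    (u : MonDeg n d) : coeffVec d F u = F.coeff u.1 :=
  rfl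

theorem coeff_homogPoly [CommSemiring R] {d : ℕ} (f : MonDeg n d → R) (u : Fin (n + 1) →₀ ℕ) :
    (homogPoly f).coeff u = if h : u.degree = d then f ⟨u, h⟩ else 0 := by
  classical
  simp only [homogPoly, MvPolynomial.coeff_sum, MvPolynomial.coeff_monomial]
  split_ifs with h
  · rw [Finset.sum_eq_single ⟨u, h⟩]
    · simp
    · intro v _ hv
      exact if_neg fun huv => hv (Subtype.ext huv)
    · simp
  · refine Finset.sum_eq_zero fun v _ => if_neg ?_
    rintro rfl
    exact h v.2

theorem coeffVec_homogPoly_self [CommSemiring R] {d : ℕ} (f : MonDeg n d → R) :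
    coeffVec d (homogPoly f) = f := by
  funext u
  rw [coeffVec_apply, coeff_homogPoly, dif_pos u.2]

theorem coeffVec_homogPoly_of_ne [CommSemiring R] {d d' : ℕ} (h : d ≠ d') (f : MonDeg n d → R) :
    coeffVec d' (homogPoly f) = 0 := by
  funext u
  rw [coeffVec_apply, coeff_homogPoly, dif_neg (fun hu => h (hu.symm.trans u.2)), Pi.zero_apply]

theorem sum_homogPoly_coeffVec [CommSemiring R] (F : MvPolynomial (Fin (n + 1)) R) :
    ∑ d ∈ Finset.range (F.totalDegree + 1), homogPoly (coeffVec d F) = F := by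
  ext u
  simp only [MvPolynomial.coeff_sum, coeff_homogPoly, coeffVec_apply, dite_eq_ite]
  rw [Finset.sum_ite_eq]
  split_ifs with h
  · rfl
  · symm
    apply MvPolynomial.coeff_eq_zero_of_totalDegree_lt
    rw [Finset.mem_range, Finsupp.degree_apply] at h
    omega

theorem coeffVec_zero_mul_X [CommSemiring R] (i : Fin (n + 1)) (F : MvPolynomial (Fin (n + 1)) R) :
    coeffVec 0 (F * MvPolynomial.X i) = 0 := by
  funext u
  have hu : u.1 = 0 := (Finsupp.degree_eq_zero_iff u.1).1 u.2
  rw [coeffVec_apply, hu, MvPolynomial.coeff_mul_X', if_neg (by simp), Pi.zero_apply]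

theorem coeffVec_succ_mul_X [CommSemiring R] (d : ℕ) (i : Fin (n + 1))
    (F : MvPolynomial (Fin (n + 1)) R) :
    coeffVec (d + 1) (F * MvPolynomial.X i) =
      Function.extend (MonDeg.mulVar i) (coeffVec d F) 0 := by
  funext u
  by_cases h : ∃ v, MonDeg.mulVar i v = u
  · obtain ⟨v, rfl⟩ := h
    rw [(MonDeg.mulVar_injective i).extend_apply]
    exact MvPolynomial.coeff_mul_X _ _ _
  · rw [Function.extend_apply' _ _ _ h, coeffVec_apply, MvPolynomial.coeff_mul_X', if_neg,
      Pi.zero_apply]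
    intro hi
    have hle : Finsupp.single i 1 ≤ u.1 := by
      rw [Finsupp.single_le_iff]
      exact Nat.one_le_iff_ne_zero.2 (Finsupp.mem_support_iff.1 hi)
    have hu : u.1 - Finsupp.single i 1 + Finsupp.single i 1 = u.1 := tsub_add_cancel_of_le hle
    refine h ⟨⟨u.1 - Finsupp.single i 1, ?_⟩, Subtype.ext hu⟩
    have hdeg := congrArg Finsupp.degree hu
    rw [map_add, Finsupp.degree_single, u.2] at hdeg
    exact Nat.succ_injective hdeg

variable [Semifield R] [LinearOrder R]

/-- A polynomial belongs to the generated subsemimodule iff its homogeneous parts are vectors. -/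
theorem mem_generatedSemimodule_iff {M : (d : ℕ) → ValuatedMatroid (MonDeg n d) R}
    {F : MvPolynomial (Fin (n + 1)) R} :
    F ∈ generatedSemimodule M ↔ ∀ d, coeffVec d F ∈ (M d).vectors := by
  constructor
  · intro hF d
    suffices generatedSemimodule M ≤ (M d).vectors.comap (coeffVec d) from this hF
    refine Submodule.span_le.2 (Set.iUnion_subset fun d' => ?_)
    rintro _ ⟨f, hf, rfl⟩
    rw [SetLike.mem_coe, Submodule.mem_comap]
    by_cases h : d' = d
    · subst h
      rw [coeffVec_homogPoly_self]
      exact hf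
    · rw [coeffVec_homogPoly_of_ne h]
      exact Submodule.zero_mem _
  · intro h
    rw [← sum_homogPoly_coeffVec F]
    exact Submodule.sum_mem _ fun d _ =>
      Submodule.subset_span (Set.mem_iUnion.2 ⟨d, _, h d, rfl⟩)

/-- Compatibility is closure of the vectors under multiplication by the variables. -/
theorem isCompatibleSeq_iff_extend_mem {M : (d : ℕ) → ValuatedMatroid (MonDeg n d) R} :
    IsCompatibleSeq M ↔ ∀ (d : ℕ) (i : Fin (n + 1)), ∀ f ∈ (M d).vectors,
      Function.extend (MonDeg.mulVar i) f 0 ∈ (M (d + 1)).vectors := by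
  constructor
  · rintro ⟨J, -, hJ⟩ d i f hf
    have hmem : ∀ F, F ∈ J ↔ F ∈ generatedSemimodule M := fun F => Set.ext_iff.1 hJ F
    have h1 : homogPoly f ∈ J :=
      (hmem _).2 (Submodule.subset_span (Set.mem_iUnion.2 ⟨d, f, hf, rfl⟩))
    have h2 := mem_generatedSemimodule_iff.1
      ((hmem _).1 (J.mul_mem_right (MvPolynomial.X i) h1)) (d + 1)
    rwa [coeffVec_succ_mul_X, coeffVec_homogPoly_self] at h2
  · intro h
    have hX : ∀ (i : Fin (n + 1)), ∀ F ∈ generatedSemimodule M,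
        F * MvPolynomial.X i ∈ generatedSemimodule M := by
      intro i F hF
      rw [mem_generatedSemimodule_iff] at hF ⊢
      intro d
      cases d with
      | zero =>
        rw [coeffVec_zero_mul_X]
        exact Submodule.zero_mem _
      | succ d =>
        rw [coeffVec_succ_mul_X]
        exact h d i _ (hF d)
    have hmul : ∀ G : MvPolynomial (Fin (n + 1)) R, ∀ F ∈ generatedSemimodule M,
        G * F ∈ generatedSemimodule M := by
      intro G
      induction G using MvPolynomial.induction_on with
      | C a =>
        intro F hF
        rw [← MvPolynomial.smul_eq_C_mul]
        exact Submodule.smul_mem _ a hF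
      | add p q hp hq =>
        intro F hF
        rw [add_mul]
        exact Submodule.add_mem _ (hp F hF) (hq F hF)
      | mul_X p i hp =>
        intro F hF
        rw [mul_right_comm]
        exact hX i _ (hp F hF)
    refine ⟨{ (generatedSemimodule M).toAddSubmonoid with
      smul_mem' := fun G F hF => hmul G F hF }, ?_, rfl⟩
    intro e F hF
    change F ∈ generatedSemimodule M at hF
    suffices MvPolynomial.homogeneousComponent e F ∈ generatedSemimodule M by
      rw [← MvPolynomial.decomposition.decompose'_apply] at this
      exact this
    rw [mem_generatedSemimodule_iff] at hF ⊢
    intro d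
    by_cases hde : d = e
    · subst hde
      convert hF d using 1
      funext u
      rw [coeffVec_apply, MvPolynomial.coeff_homogeneousComponent, if_pos u.2, coeffVec_apply]
    · convert Submodule.zero_mem (M d).vectors using 1
      funext u
      rw [coeffVec_apply, MvPolynomial.coeff_homogeneousComponent,
        if_neg (fun hu => hde (u.2.symm.trans hu)), Pi.zero_apply]

end HomogeneousParts

/-! ### The criterion in terms of basis valuations -/

/-- The condition for `U` and `V` says that the circuit of `U`, multiplied by `x_i`, is
orthogonal to the cocircuit of `V`: all terms outside `x_i U \ V` are `∞`. -/
theorem extend_circuitOf_mem_orthogonal_iff {R : Type*} [Semifield R] [LinearOrder R]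
    [ValuativeSemifield R] {n d : ℕ} (M : ValuatedMatroid (MonDeg n d) R)
    (N : ValuatedMatroid (MonDeg n (d + 1)) R) (i : Fin (n + 1)) {U : Finset (MonDeg n d)}
    {V : Finset (MonDeg n (d + 1))} (hU : U.card = M.rank + 1) (hV : V.card + 1 = N.rank) :
    Function.extend (MonDeg.mulVar i) (M.circuitOf U) 0 ∈
        ValuativeSemifield.orthogonal (N.cocircuitOf V) ↔
      MinAttainedTwice (U.filter fun v => v.mulVar i ∉ V)
        (fun v => M.p (U.erase v) * N.p (insert (v.mulVar i) V)) := by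
  have hext : ∀ v, Function.extend (MonDeg.mulVar i) (M.circuitOf U) 0 (v.mulVar i) *
      N.cocircuitOf V (v.mulVar i) = M.p (U.erase v) * N.p (insert (v.mulVar i) V) := by
    intro v
    rw [(MonDeg.mulVar_injective i).extend_apply]
    rfl
  have hrange : ∀ u, Function.extend (MonDeg.mulVar i) (M.circuitOf U) 0 u *
      N.cocircuitOf V u ≠ 0 → ∃ v ∈ U.filter fun v => v.mulVar i ∉ V, v.mulVar i = u := by
    intro u hu
    have h0 := left_ne_zero_of_mul hu
    by_cases h : ∃ v, MonDeg.mulVar i v = u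
    · obtain ⟨v, rfl⟩ := h
      rw [(MonDeg.mulVar_injective i).extend_apply] at h0
      exact ⟨v, Finset.mem_filter.2 ⟨M.circuitOf_ne_zero hU h0,
        N.cocircuitOf_ne_zero hV (right_ne_zero_of_mul hu)⟩, rfl⟩
    · rw [Function.extend_apply' _ _ _ h] at h0
      exact absurd rfl h0
  rw [ValuativeSemifield.minAttainedTwice_iff, ValuativeSemifield.mem_orthogonal]
  constructor
  · intro h v _ hv
    rw [← hext] at hv
    obtain ⟨u, hne, hle⟩ := h _ hv
    obtain ⟨w, hw, rfl⟩ := hrange u (ValuativeSemifield.ne_zero_of_le hle hv)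
    rw [hext, hext] at hle
    exact ⟨w, hw, fun hwv => hne (congrArg _ hwv), hle⟩
  · intro h u hu
    obtain ⟨v, hv, rfl⟩ := hrange u hu
    rw [hext] at hu
    obtain ⟨w, -, hne, hle⟩ := h v hv hu
    refine ⟨w.mulVar i, (MonDeg.mulVar_injective i).ne hne, ?_⟩
    rwa [hext, hext]

theorem mainTheorem12 {R : Type*} [Semifield R] [LinearOrder R] [ValuativeSemifield R] (n : ℕ)
    (M : (d : ℕ) → ValuatedMatroid (MonDeg n d) R) :
    IsCompatibleSeq M ↔
      ∀ (d : ℕ) (i : Fin (n + 1)) (U : Finset (MonDeg n d)) (V : Finset (MonDeg n (d + 1))),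
        U.card = (M d).rank + 1 → V.card + 1 = (M (d + 1)).rank →
          MinAttainedTwice (U.filter fun v => v.mulVar i ∉ V)
            (fun v => (M d).p (U.erase v) * (M (d + 1)).p (insert (v.mulVar i) V)) := by
  rw [isCompatibleSeq_iff_extend_mem]
  constructor
  · intro h d i U V hU hV
    rw [← extend_circuitOf_mem_orthogonal_iff (M d) (M (d + 1)) i hU hV]
    exact (M (d + 1)).mem_vectors_iff.1
      (h d i _ ((M d).circuitOf_mem_vectors hU)) V hV
  · intro h d i f hf
    rw [ValuatedMatroid.vectors_eq_span_circuitOf] at hf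
    induction hf using Submodule.span_induction with
    | mem x hx =>
      obtain ⟨U, hU, rfl⟩ := hx
      exact (M (d + 1)).mem_vectors_iff.2 fun V hV =>
        (extend_circuitOf_mem_orthogonal_iff (M d) (M (d + 1)) i hU hV).2 (h d i U V hU hV)
    | zero =>
      convert Submodule.zero_mem (M (d + 1)).vectors using 1
      exact Function.extend_const _ (0 : R)
    | add x y _ _ hx hy =>
      convert Submodule.add_mem _ hx hy using 1
      have := Function.extend_add (MonDeg.mulVar i) x y (0 : MonDeg n (d + 1) → R) 0
      rwa [add_zero] at this
    | smul a x _ hx =>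
      convert Submodule.smul_mem _ a hx using 1
      have := Function.extend_smul a (MonDeg.mulVar i) x (0 : MonDeg n (d + 1) → R)
      rwa [smul_zero] at this
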